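/- Let $\mathcal{X}$ be a measurable space, let $\mathcal{Z}\subseteq\mathbb{R}^{k}$ and $\mathcal{C}\subseteq\mathbb{R}^{l}$, and let $(X,C)$ be a random element of $\mathcal{X}\times\mathcal{C}$ with a fixed regular version $\mathbb{P}_{X|C}(\cdot|c)$, $c\in\mathcal{C}$, of the conditional law of $X$ given $C$. Let $\mathrm{Enc}:\mathcal{X}\times\mathcal{C}\to\mathcal{Z}$ and $\mathrm{Gen}:\mathcal{Z}\times\mathcal{C}\to\mathcal{X}$ be measurable. For $c\in\mathcal{C}$ let $\mathbb{P}_{(X,C)|C}(\cdot|c)$ and $\mathbb{P}_{\mathrm{Enc}(X,C)|C}(\cdot|c)$ be the images of $\mathbb{P}_{X|C}(\cdot|c)$ under $x\mapsto(x,c)$ and $x\mapsto\mathrm{Enc}(x,c)$. Write $\|\cdot\|$ for Euclidean norms, put $$d_{\mathrm{Enc}}\big((x_1,c_1),(x_2,c_2)\big):=\big\|(\mathrm{Enc}(x_1,c_1),c_1)-(\mathrm{Enc}(x_2,c_2),c_2)\big\|,$$ and let $W_2(\mathbb{P},\mathbb{Q};d):=\big(\inf_{\pi\in\Pi(\mathbb{P},\mathbb{Q})}\int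 d^{2}\,d\pi\big)^{1/2}\in[0,\infty]$, where $\Pi(\mathbb{P},\mathbb{Q})$ is the set of couplings of $\mathbb{P}$ and $\mathbb{Q}$. Let $\mathcal{P}(S)$ be the set of probability measures on $S$. Assume: (A1) $\mathrm{Gen}(\mathrm{Enc}(x,c),c)=x$ and $\mathrm{Enc}(\mathrm{Gen}(z,c),c)=z$ for all $x\in\mathcal{X}$, $z\in\mathcal{Z}$, $c\in\mathcal{C}$. (A2) For every $c\in\mathcal{C}$, the law $\mathbb{P}_{\mathrm{Enc}(X,C)|C}(\cdot|c)$ is absolutely continuous with respect to Lebesgue measure on $\mathbb{R}^{k}$, is concentrated on a compact set, and has a finite second moment. Let $c_1,\dots,c_M\in\mathcal{C}$, let $\alpha_1,\dots,\alpha_M\ge 0$ with $\sum_{m=1}^{M}\alpha_m=1$, and suppose that $\bar c:=\sum_{m=1}^{M}\alpha_m c_m$ belongs to $\mathcal{C}$. Then $$\inf_{\mathbb{P}\in\bigcup_{c\in\mathcal{C}}\mathcal{P}(\mathcal{X}\times\{c\})}\ \sum_{m=1}^{M}\alpha_m W_2^2\big(\mathbb{P},\mathbb{P}_{(X,C)|C}(\cdot|c_m);d_{\mathrm{Enc}}\big)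 =\inf_{\mathbb{P}\in\mathcal{P}(\mathcal{Z})}\ \sum_{m=1}^{M}\alpha_m W_2^2\big(\mathbb{P},\mathbb{P}_{\mathrm{Enc}(X,C)|C}(\cdot|c_m);\|\cdot\|\big)+\sum_{m=1}^{M}\alpha_m\|\bar c-c_m\|^2 .$$ -/

import Mathlib

open MeasureTheory ProbabilityTheory
open scoped ENNReal

noncomputable section

namespace LatentGeodesic

/-- The couplings `Π(P, Q)`: measures on the product with marginals `P` and `Q`. -/
def couplings {S : Type*} [MeasurableSpace S] (P Q : Measure S) : Set (Measure (S × S)) :=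
  {π | π.map Prod.fst = P ∧ π.map Prod.snd = Q}

/-- The `p`-Wasserstein distance `W_p(P, Q; d)` with respect to `d`, with values in `[0, ∞]`. -/
def wasserstein {S : Type*} [MeasurableSpace S] (p : ℝ) (d : S → S → ℝ) (P Q : Measure S) :
    ℝ≥0∞ :=
  (⨅ π ∈ couplings P Q, ∫⁻ s, ENNReal.ofReal (d s.1 s.2 ^ p) ∂π) ^ (1 / p)

/-- `P(S)`, the probability measures on `S`. -/
def probMeasures (S : Type*) [MeasurableSpace S] : Set (Measure S) :=
  {P | IsProbabilityMeasure P}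

/-- `⋃_c P(S × {c})`: the probability measures on `S × T` carried by a single slice `S × {c}`
with `c` in `T`. -/
def sliceMeasures (S T : Type*) [MeasurableSpace S] [MeasurableSpace T] :
    Set (Measure (S × T)) :=
  {P | IsProbabilityMeasure P ∧ ∃ c : T, ∀ᵐ y ∂P, y.2 = c}

section

variable {k l : ℕ} {𝒳 : Type*} [MeasurableSpace 𝒳]
  {𝒵 : Set (EuclideanSpace ℝ (Fin k))} {𝒞 : Set (EuclideanSpace ℝ (Fin l))}

/-- `d_Enc((x₁, c₁), (x₂, c₂)) = ‖(Enc(x₁, c₁), c₁) - (Enc(x₂, c₂), c₂)‖`, where the norm is the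
`ℓ²` norm of `ℝᵏ × ℝˡ`. -/
def dEnc (Enc : 𝒳 × 𝒞 → 𝒵) (y₁ y₂ : 𝒳 × 𝒞) : ℝ :=
  ‖WithLp.toLp 2 ((Enc y₁ : EuclideanSpace ℝ (Fin k)), (y₁.2 : EuclideanSpace ℝ (Fin l)))
    - WithLp.toLp 2 ((Enc y₂ : EuclideanSpace ℝ (Fin k)), (y₂.2 : EuclideanSpace ℝ (Fin l)))‖

/-- The Euclidean distance on the representation space. -/
def dEuc (z₁ z₂ : 𝒵) : ℝ :=
  ‖(z₁ : EuclideanSpace ℝ (Fin k)) - (z₂ : EuclideanSpace ℝ (Fin k))‖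

/-- The conditional law of `(X, C)` given `C = c`, where `κ` is the conditional law of `X`
given `C`. -/
def condPair (κ : Kernel 𝒞 𝒳) (c : 𝒞) : Measure (𝒳 × 𝒞) :=
  (κ c).map fun x => (x, c)

/-- The conditional law of `Enc(X, C)` given `C = c`, where `κ` is the conditional law of `X`
given `C`. -/
def condEnc (Enc : 𝒳 × 𝒞 → 𝒵) (κ : Kernel 𝒞 𝒳) (c : 𝒞) : Measure 𝒵 :=
  (κ c).map fun x => Enc (x, c)

/-- One-to-one mapping between `𝒳 × 𝒞` and `𝒵 × 𝒞`: for each label, encoder and generator are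
inverse to each other. -/
def OneToOne (Enc : 𝒳 × 𝒞 → 𝒵) (Gen : 𝒵 × 𝒞 → 𝒳) : Prop :=
  (∀ x c, Gen (Enc (x, c), c) = x) ∧ ∀ z c, Enc (Gen (z, c), c) = z

/-- Absolutely continuous representations: for each label, the conditional law of the
representation is absolutely continuous with respect to Lebesgue measure on `ℝᵏ`, is carried by a
compact set, and has finite second moment. -/
def AbsContRepresentations (Enc : 𝒳 × 𝒞 → 𝒵) (κ : Kernel 𝒞 𝒳) : Prop :=
  ∀ c : 𝒞,
    (condEnc Enc κ c).map (Subtype.val : 𝒵 → EuclideanSpace ℝ (Fin k)) ≪ volume ∧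
    (∃ K : Set (EuclideanSpace ℝ (Fin k)), IsCompact K ∧
      ∀ᵐ z : 𝒵 ∂(condEnc Enc κ c), (z : EuclideanSpace ℝ (Fin k)) ∈ K) ∧
    ∫⁻ z : 𝒵, ENNReal.ofReal (‖(z : EuclideanSpace ℝ (Fin k))‖ ^ 2) ∂(condEnc Enc κ c) < ∞

end

end LatentGeodesic

end

/-!
For each label `c` the encoder identifies the slice `𝒳 × {c}` with `𝒵`, its inverse being
`z ↦ (Gen (z, c), c)`. If `P` and `P'` are carried by the slices over `c` and `c'`, pushing couplings
back and forth along these identifications matches the couplings of `P` and `P'` with the couplings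
of their encoded laws. Along such a coupling the squared distance `dEnc` is the squared distance
between the representations plus the constant `‖c - c'‖²`, so that (`wasserstein_slice_sq`)

  `W₂²(P, P'; dEnc) = W₂²(Enc_* P, Enc_* P'; ‖·‖) + ‖c - c'‖²`.

The objective over the slice at `c` is therefore the objective on `𝒵` plus `∑ αₘ ‖c - cₘ‖²`. The two
terms can be minimised separately: every probability measure on `𝒵` is the encoded law of one on any
prescribed slice, and the second term is least at the barycentre `c̄` (`sum_mul_norm_sub_sq`).
-/

namespace LatentGeodesic

theorem wasserstein_two_sq {S : Type*} [MeasurableSpace S] (d : S → S → ℝ) (P Q : Measure S) :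
    wasserstein 2 d P Q ^ 2
      = ⨅ π ∈ couplings P Q, ∫⁻ s, ENNReal.ofReal (d s.1 s.2 ^ (2 : ℝ)) ∂π := by
  rw [wasserstein, ← ENNReal.rpow_natCast, ← ENNReal.rpow_mul]
  norm_num

theorem isProbabilityMeasure_of_mem_couplings {S : Type*} [MeasurableSpace S] {P Q : Measure S}
    [IsProbabilityMeasure P] {π : Measure (S × S)} (hπ : π ∈ couplings P Q) :
    IsProbabilityMeasure π := by
  constructor
  rw [← Set.preimage_univ (f := Prod.fst), ← Measure.map_apply measurable_fst MeasurableSet.univ,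
    hπ.1, measure_univ]

theorem map_prodMap_mem_couplings {S T : Type*} [MeasurableSpace S] [MeasurableSpace T]
    {P Q : Measure S} {f g : S → T} (hf : Measurable f) (hg : Measurable g)
    {π : Measure (S × S)} (hπ : π ∈ couplings P Q) :
    π.map (Prod.map f g) ∈ couplings (P.map f) (Q.map g) := by
  constructor
  · rw [Measure.map_map measurable_fst (hf.prodMap hg), ← hπ.1, Measure.map_map hf measurable_fst]
    rfl
  · rw [Measure.map_map measurable_snd (hf.prodMap hg), ← hπ.2, Measure.map_map hg measurable_snd]
    rfl

/-- The bias-variance identity: the weighted mean square distance to the points `x i` exceeds its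
value at their barycentre by the squared distance to the barycentre. -/
theorem sum_mul_norm_sub_sq {ι E : Type*} [NormedAddCommGroup E] [InnerProductSpace ℝ E]
    (s : Finset ι) (α : ι → ℝ) (x : ι → E) (hα : ∑ i ∈ s, α i = 1) (y : E) :
    ∑ i ∈ s, α i * ‖y - x i‖ ^ 2
      = ∑ i ∈ s, α i * ‖(∑ j ∈ s, α j • x j) - x i‖ ^ 2 + ‖y - ∑ j ∈ s, α j • x j‖ ^ 2 := by
  set b := ∑ j ∈ s, α j • x j with hb
  have expand (i : ι) : α i * ‖y - x i‖ ^ 2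
      = α i * ‖y - b‖ ^ 2 + 2 * inner ℝ (y - b) (α i • (b - x i)) + α i * ‖b - x i‖ ^ 2 := by
    rw [← sub_add_sub_cancel y b (x i), norm_add_sq_real, inner_smul_right]
    ring
  have centred : ∑ i ∈ s, α i • (b - x i) = 0 := by
    simp_rw [smul_sub]
    rw [Finset.sum_sub_distrib, ← Finset.sum_smul, hα, one_smul, ← hb, sub_self]
  simp_rw [expand]
  rw [Finset.sum_add_distrib, Finset.sum_add_distrib, ← Finset.sum_mul, ← Finset.mul_sum,
    ← inner_sum, centred, hα, inner_zero_right]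
  ring

variable {k l : ℕ} {𝒳 : Type*} [MeasurableSpace 𝒳]
  {𝒵 : Set (EuclideanSpace ℝ (Fin k))} {𝒞 : Set (EuclideanSpace ℝ (Fin l))}

theorem measurable_dEuc_rpow :
    Measurable fun s : 𝒵 × 𝒵 => ENNReal.ofReal (dEuc s.1 s.2 ^ (2 : ℝ)) := by
  unfold dEuc
  fun_prop

theorem ofReal_dEnc_rpow {𝒳 : Type*} (Enc : 𝒳 × 𝒞 → 𝒵) (y₁ y₂ : 𝒳 × 𝒞) :
    ENNReal.ofReal (dEnc Enc y₁ y₂ ^ (2 : ℝ))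
      = ENNReal.ofReal (dEuc (Enc y₁) (Enc y₂) ^ (2 : ℝ)) + ENNReal.ofReal
          (‖(y₁.2 : EuclideanSpace ℝ (Fin l)) - (y₂.2 : EuclideanSpace ℝ (Fin l))‖ ^ 2) := by
  rw [← ENNReal.ofReal_add (by unfold dEuc; positivity) (by positivity), Real.rpow_two,
    Real.rpow_two, dEnc, dEuc, WithLp.prod_norm_sq_eq_of_L2]
  rfl

theorem measurable_dEnc_rpow {Enc : 𝒳 × 𝒞 → 𝒵} (hEnc : Measurable Enc) :
    Measurable fun s : (𝒳 × 𝒞) × (𝒳 × 𝒞) => ENNReal.ofReal (dEnc Enc s.1 s.2 ^ (2 : ℝ)) := by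
  simp_rw [ofReal_dEnc_rpow]
  exact (measurable_dEuc_rpow.comp (hEnc.prodMap hEnc)).add (by fun_prop)

/-- The inverse of the encoder on the slice over `c`. -/
def decode (Gen : 𝒵 × 𝒞 → 𝒳) (c : 𝒞) (z : 𝒵) : 𝒳 × 𝒞 := (Gen (z, c), c)

theorem measurable_decode {Gen : 𝒵 × 𝒞 → 𝒳} (hGen : Measurable Gen) (c : 𝒞) :
    Measurable (decode Gen c) := by
  unfold decode
  fun_prop

theorem map_encode_map_decode {Enc : 𝒳 × 𝒞 → 𝒵} {Gen : 𝒵 × 𝒞 → 𝒳} (hEnc : Measurable Enc)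
    (hGen : Measurable Gen) (h : OneToOne Enc Gen) (c : 𝒞) (Q : Measure 𝒵) :
    (Q.map (decode Gen c)).map Enc = Q := by
  rw [Measure.map_map hEnc (measurable_decode hGen c)]
  exact (congrArg Q.map (funext fun z => h.2 z c)).trans Measure.map_id

theorem map_decode_map_encode {Enc : 𝒳 × 𝒞 → 𝒵} {Gen : 𝒵 × 𝒞 → 𝒳} (hEnc : Measurable Enc)
    (hGen : Measurable Gen) (h : OneToOne Enc Gen) {c : 𝒞} {P : Measure (𝒳 × 𝒞)}
    (hP : ∀ᵐ y ∂P, y.2 = c) : (P.map Enc).map (decode Gen c) = P := by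
  rw [Measure.map_map (measurable_decode hGen c) hEnc]
  refine (Measure.map_congr (g := id) ?_).trans Measure.map_id
  filter_upwards [hP]
  rintro ⟨x, _⟩ rfl
  exact Prod.ext (h.1 x _) rfl

theorem ae_map_decode {Gen : 𝒵 × 𝒞 → 𝒳} (hGen : Measurable Gen) (c : 𝒞) (Q : Measure 𝒵) :
    ∀ᵐ y ∂Q.map (decode Gen c), y.2 = c := by
  have hs : MeasurableSet {y : 𝒳 × 𝒞 | y.2 = c} := measurable_snd (measurableSet_singleton c)
  exact (ae_map_iff (measurable_decode hGen c).aemeasurable hs).2 (.of_forall fun _ => rfl)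

/-- Along a coupling of measures carried by the slices over `c` and `c'`, the transport cost is that
of the encoded coupling plus the constant `‖c - c'‖²`. -/
theorem lintegral_dEnc_of_mem_couplings {Enc : 𝒳 × 𝒞 → 𝒵} (hEnc : Measurable Enc)
    {c c' : 𝒞} {P P' : Measure (𝒳 × 𝒞)} [IsProbabilityMeasure P]
    (hP : ∀ᵐ y ∂P, y.2 = c) (hP' : ∀ᵐ y ∂P', y.2 = c') {π : Measure ((𝒳 × 𝒞) × (𝒳 × 𝒞))}
    (hπ : π ∈ couplings P P') :
    ∫⁻ s, ENNReal.ofReal (dEnc Enc s.1 s.2 ^ (2 : ℝ)) ∂π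
      = ∫⁻ s, ENNReal.ofReal (dEuc s.1 s.2 ^ (2 : ℝ)) ∂(π.map (Prod.map Enc Enc))
        + ENNReal.ofReal
          (‖(c : EuclideanSpace ℝ (Fin l)) - (c' : EuclideanSpace ℝ (Fin l))‖ ^ 2) := by
  have := isProbabilityMeasure_of_mem_couplings hπ
  have h₁ : ∀ᵐ s ∂π, s.1.2 = c := ae_of_ae_map measurable_fst.aemeasurable (hπ.1 ▸ hP)
  have h₂ : ∀ᵐ s ∂π, s.2.2 = c' := ae_of_ae_map measurable_snd.aemeasurable (hπ.2 ▸ hP')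
  rw [lintegral_map measurable_dEuc_rpow (hEnc.prodMap hEnc)]
  calc
    _ = ∫⁻ s, (ENNReal.ofReal (dEuc (Enc s.1) (Enc s.2) ^ (2 : ℝ)) + ENNReal.ofReal
          (‖(c : EuclideanSpace ℝ (Fin l)) - (c' : EuclideanSpace ℝ (Fin l))‖ ^ 2)) ∂π := by
      refine lintegral_congr_ae ?_
      filter_upwards [h₁, h₂] with s hs₁ hs₂
      rw [ofReal_dEnc_rpow, hs₁, hs₂]
    _ = _ := by
      rw [lintegral_add_right _ measurable_const, lintegral_const, measure_univ, mul_one]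
      rfl

/-- Between two slices, the squared Wasserstein distance for `dEnc` splits into the squared
distance of the encoded laws and the squared distance of the labels. -/
theorem wasserstein_slice_sq {Enc : 𝒳 × 𝒞 → 𝒵} {Gen : 𝒵 × 𝒞 → 𝒳} (hEnc : Measurable Enc)
    (hGen : Measurable Gen) (h : OneToOne Enc Gen) {c c' : 𝒞} {P P' : Measure (𝒳 × 𝒞)}
    [IsProbabilityMeasure P] (hP : ∀ᵐ y ∂P, y.2 = c) (hP' : ∀ᵐ y ∂P', y.2 = c') :
    wasserstein 2 (dEnc Enc) P P' ^ 2
      = wasserstein 2 dEuc (P.map Enc) (P'.map Enc) ^ 2 + ENNReal.ofReal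
          (‖(c : EuclideanSpace ℝ (Fin l)) - (c' : EuclideanSpace ℝ (Fin l))‖ ^ 2) := by
  simp_rw [wasserstein_two_sq, ENNReal.iInf_add]
  refine le_antisymm (le_iInf₂ fun ρ hρ => ?_) (le_iInf₂ fun π hπ => ?_)
  · have hdec := (measurable_decode hGen c).prodMap (measurable_decode hGen c')
    have hmem := map_prodMap_mem_couplings (measurable_decode hGen c) (measurable_decode hGen c') hρ
    rw [map_decode_map_encode hEnc hGen h hP, map_decode_map_encode hEnc hGen h hP'] at hmem
    refine (iInf₂_le _ hmem).trans_eq ?_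
    rw [lintegral_dEnc_of_mem_couplings hEnc hP hP' hmem, Measure.map_map (hEnc.prodMap hEnc) hdec]
    have : Prod.map Enc Enc ∘ Prod.map (decode Gen c) (decode Gen c') = id :=
      funext fun z => Prod.ext (h.2 z.1 c) (h.2 z.2 c')
    rw [this, Measure.map_id]
  · rw [lintegral_dEnc_of_mem_couplings hEnc hP hP' hπ]
    exact iInf₂_le _ (map_prodMap_mem_couplings hEnc hEnc hπ)

theorem map_encode_condPair {Enc : 𝒳 × 𝒞 → 𝒵} (hEnc : Measurable Enc) (κ : Kernel 𝒞 𝒳) (c : 𝒞) :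
    (condPair κ c).map Enc = condEnc Enc κ c :=
  Measure.map_map hEnc measurable_prodMk_right

theorem ae_condPair (κ : Kernel 𝒞 𝒳) (c : 𝒞) : ∀ᵐ y ∂condPair κ c, y.2 = c := by
  have hs : MeasurableSet {y : 𝒳 × 𝒞 | y.2 = c} := measurable_snd (measurableSet_singleton c)
  exact (ae_map_iff measurable_prodMk_right.aemeasurable hs).2 (.of_forall fun _ => rfl)

/-- The barycentre objective at a measure on the slice over `c'` is the objective in the
representation space plus a term that depends on `c'` alone. -/
theorem sum_wasserstein_slice {M : ℕ} {Enc : 𝒳 × 𝒞 → 𝒵} {Gen : 𝒵 × 𝒞 → 𝒳} (hEnc : Measurable Enc)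
    (hGen : Measurable Gen) (h : OneToOne Enc Gen) (κ : Kernel 𝒞 𝒳) (c : Fin M → 𝒞)
    {α : Fin M → ℝ} (hα : ∀ m, 0 ≤ α m) {c' : 𝒞} {P : Measure (𝒳 × 𝒞)} [IsProbabilityMeasure P]
    (hP : ∀ᵐ y ∂P, y.2 = c') :
    ∑ m, ENNReal.ofReal (α m) * wasserstein 2 (dEnc Enc) P (condPair κ (c m)) ^ 2
      = ∑ m, ENNReal.ofReal (α m) * wasserstein 2 dEuc (P.map Enc) (condEnc Enc κ (c m)) ^ 2
        + ENNReal.ofReal (∑ m, α m *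
            ‖(c' : EuclideanSpace ℝ (Fin l)) - (c m : EuclideanSpace ℝ (Fin l))‖ ^ 2) := by
  rw [ENNReal.ofReal_sum_of_nonneg fun m _ => mul_nonneg (hα m) (sq_nonneg _),
    ← Finset.sum_add_distrib]
  refine Finset.sum_congr rfl fun m _ => ?_
  rw [wasserstein_slice_sq hEnc hGen h hP (ae_condPair κ (c m)), map_encode_condPair hEnc, mul_add,
    ← ENNReal.ofReal_mul (hα m)]

end LatentGeodesic

open LatentGeodesic in
theorem lemma2 {k l M : ℕ}
    {Ω : Type*} [MeasurableSpace Ω] (μ : Measure Ω) [IsProbabilityMeasure μ]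
    {𝒳 : Type*} [MeasurableSpace 𝒳]
    (𝒵 : Set (EuclideanSpace ℝ (Fin k))) (𝒞 : Set (EuclideanSpace ℝ (Fin l)))
    (X : Ω → 𝒳) (C : Ω → 𝒞)
    (κ : Kernel 𝒞 𝒳) [IsMarkovKernel κ] (hκ : HasCondDistrib X C κ μ)
    (Enc : 𝒳 × 𝒞 → 𝒵) (hEnc : Measurable Enc)
    (Gen : 𝒵 × 𝒞 → 𝒳) (hGen : Measurable Gen)
    (hA1 : OneToOne Enc Gen) (hA2 : AbsContRepresentations Enc κ)
    (c : Fin M → 𝒞) (α : Fin M → ℝ) (hα : ∀ m, 0 ≤ α m) (hα1 : ∑ m, α m = 1)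
    (cbar : EuclideanSpace ℝ (Fin l))
    (hcbar : cbar = ∑ m, α m • (c m : EuclideanSpace ℝ (Fin l))) (hmem : cbar ∈ 𝒞) :
    (⨅ P ∈ sliceMeasures 𝒳 𝒞,
        ∑ m, ENNReal.ofReal (α m) * wasserstein 2 (dEnc Enc) P (condPair κ (c m)) ^ 2)
      = (⨅ P ∈ probMeasures 𝒵,
          ∑ m, ENNReal.ofReal (α m) * wasserstein 2 dEuc P (condEnc Enc κ (c m)) ^ 2)
        + ENNReal.ofReal
            (∑ m, α m * ‖cbar - (c m : EuclideanSpace ℝ (Fin l))‖ ^ 2) := by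
  simp_rw [ENNReal.iInf_add]
  refine le_antisymm (le_iInf₂ fun Q hQ => ?_) (le_iInf₂ fun P hP => ?_)
  · have : IsProbabilityMeasure Q := hQ
    have hprob : IsProbabilityMeasure (Q.map (decode Gen ⟨cbar, hmem⟩)) :=
      Measure.isProbabilityMeasure_map (measurable_decode hGen _).aemeasurable
    have hslice := ae_map_decode hGen ⟨cbar, hmem⟩ Q
    refine (iInf₂_le _ ⟨hprob, _, hslice⟩).trans_eq ?_
    rw [sum_wasserstein_slice hEnc hGen hA1 κ c hα hslice, map_encode_map_decode hEnc hGen hA1]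
  · obtain ⟨hprob, c', hslice⟩ := hP
    rw [sum_wasserstein_slice hEnc hGen hA1 κ c hα hslice]
    refine (iInf₂_le (P.map Enc) (Measure.isProbabilityMeasure_map hEnc.aemeasurable)).trans ?_
    refine add_le_add_right (ENNReal.ofReal_le_ofReal ?_) _
    rw [sum_mul_norm_sub_sq Finset.univ α (fun m => (c m : EuclideanSpace ℝ (Fin l))) hα1 c',
      ← hcbar]
    exact le_add_of_nonneg_right (sq_nonneg _)
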